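/- Let $k\ge 4$ and let $P$ be a closed convex $k$-gon in the Euclidean plane, i.e. the convex hull of $k$ points none of which lies in the convex hull of the others. Let $\mathcal T$ be a finite family of closed nondegenerate triangles whose union is $P$ and no two of which have a common interior point. Then there are two distinct triangles in $\mathcal T$ that share an edge, that is, some segment is a full side of both triangles. -/

import Mathlib

/-- The Euclidean plane. -/
abbrev Plane : Type := EuclideanSpace ℝ (Fin 2)

/-- `P` is a closed convex polygon with exactly `k` vertices: the convex hull of `k` points in
(strictly) convex position, none of them lying in the convex hull of the others.
(Meant for `k ≥ 3`.) -/
def IsConvexGon (k : ℕ) (P : Set Plane) : Prop :=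
  ∃ v : Fin k → Plane, ConvexIndependent ℝ v ∧ P = convexHull ℝ (Set.range v)

/-- The family `T` of nondegenerate closed triangles tiles `P`: the triangles cover exactly `P`,
and no two of them share an interior point. -/
def IsTriangleTiling (T : Set (Affine.Triangle ℝ Plane)) (P : Set Plane) : Prop :=
  (⋃ t ∈ T, t.closedInterior) = P ∧
    ∀ s ∈ T, ∀ t ∈ T, s ≠ t → Disjoint s.interior t.interior

/-- The segment `S` is a (full) side of the triangle `t`. -/
def IsSideOf (S : Set Plane) (t : Affine.Triangle ℝ Plane) : Prop :=
  ∃ a b : Fin 3, a ≠ b ∧ S = segment ℝ (t.points a) (t.points b)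

/-! Choose a linear functional `ψ` separating all vertices of the tiling, and let `u` span its
kernel; call `u` vertical, so that no side is vertical. Suppose that no two triangles share a side.
Let n be the number of triangles, V of vertices, I of pairs (side, vertex in its relative interior),
O of sides on the boundary of the region, and let B₊, B₋ be the sets of vertices from which `u`,
respectively `-u`, does not point into the region. Five counts are combined.

3n - O ≤ 3I (`card_innerSides_le`): along an inner side lies a side of another triangle; the two do
not coincide, so an endpoint of one is inside the other.

O + 2 ≤ |B₊| + |B₋| (`card_outerSides_le`): the lower and the upper boundary each have at least one
more blocked vertex than sides.

2V ≤ n + I + |B₊| + |B₋| (`two_mul_card_verts_le`): an unblocked vertical direction at a vertex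
enters a triangle, either at a corner or through a side, and each triangle and each incidence serves
only one such direction.

I + |B₊ ∪ B₋| ≤ V (`card_incidences_add_le`) and |B₊ ∩ B₋| ≤ 2 (`card_blocked_inter_le`): a vertex
inside a side is unblocked and in no other side, and only the extremes of `ψ` are blocked both ways.

Together these give |B₊ ∪ B₋| ≤ 3. Every extreme point of the region is in B₊ ∪ B₋, so a convex
k-gon with k ≥ 4 is impossible. -/

/-- A finite tiling of a convex region by triangles, given through barycentric coordinates, together
with a linear functional `ψ` that takes distinct values at distinct vertices and a vector `u`
spanning its kernel. -/
structure GenericTiling (ι E : Type*) [AddCommGroup E] [Module ℝ E] where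
  vert : ι → Fin 3 → E
  coord : ι → Fin 3 → E →ᵃ[ℝ] ℝ
  region : Set E
  ψ : E →ₗ[ℝ] ℝ
  u : E
  coord_self : ∀ t j, coord t j (vert t j) = 1
  coord_ne : ∀ t j k, j ≠ k → coord t j (vert t k) = 0
  sum_coord : ∀ t x, ∑ j, coord t j x = 1
  sum_coord_smul : ∀ t x, ∑ j, coord t j x • vert t j = x
  eq_of_common_interior : ∀ s t x, (∀ j, 0 < coord s j x) → (∀ j, 0 < coord t j x) → s = t
  convex_region : Convex ℝ region
  mem_region : ∀ x, x ∈ region ↔ ∃ t, ∀ j, 0 ≤ coord t j x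
  ψ_u : ψ u = 0
  u_ne : u ≠ 0
  ker_ψ : ∀ v, ψ v = 0 → ∃ c : ℝ, v = c • u
  ψ_inj : ∀ s t j k, ψ (vert s j) = ψ (vert t k) → vert s j = vert t k

/-! ### Triples of indices, and affine functions along a line -/

theorem Fin.sum_eq_of_distinct {M : Type*} [AddCommMonoid M] (f : Fin 3 → M) {j a b : Fin 3}
    (hja : j ≠ a) (hjb : j ≠ b) (hab : a ≠ b) : ∑ k, f k = f j + (f a + f b) := by
  have : (Finset.univ : Finset (Fin 3)) = {j, a, b} := by
    revert j a b; decide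
  rw [this, Finset.sum_insert (by simp [hja, hjb]), Finset.sum_pair hab]

theorem Fin.eq_or_eq_or_eq {j a b : Fin 3} (hja : j ≠ a) (hjb : j ≠ b) (hab : a ≠ b) (k : Fin 3) :
    k = j ∨ k = a ∨ k = b := by
  revert j a b k; decide

theorem Fin.exists_other_two (j : Fin 3) : ∃ a b : Fin 3, j ≠ a ∧ j ≠ b ∧ a ≠ b := by
  revert j; decide

theorem AffineMap.apply_add_smul {E : Type*} [AddCommGroup E] [Module ℝ E] (f : E →ᵃ[ℝ] ℝ)
    (x w : E) (ε : ℝ) : f (x + ε • w) = f x + ε * f.linear w := by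
  have := f.map_vadd x (ε • w)
  simp only [vadd_eq_add, map_smul, smul_eq_mul] at this
  rw [add_comm x, this, add_comm]

theorem AffineMap.linear_sub_apply {E : Type*} [AddCommGroup E] [Module ℝ E] (f : E →ᵃ[ℝ] ℝ)
    (x y : E) : f.linear (x - y) = f x - f y := by
  simpa using f.linearMap_vsub x y

namespace GenericTiling

open Filter Topology

variable {ι E : Type*} [AddCommGroup E] [Module ℝ E] (C : GenericTiling ι E)

/-! ### Germs of directions -/

/-- The direction `w` points from `x` into the region. -/
def PointsIn (x w : E) : Prop := ∃ ε : ℝ, 0 < ε ∧ x + ε • w ∈ C.region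

/-- The direction `w` points from `x` into the closed triangle `t`. -/
def WeakCone (t : ι) (x w : E) : Prop :=
  ∀ j, 0 < C.coord t j x ∨ C.coord t j x = 0 ∧ 0 ≤ (C.coord t j).linear w

/-- The direction `w` points from `x` into the open triangle `t`. -/
def StrictCone (t : ι) (x w : E) : Prop :=
  ∀ j, 0 < C.coord t j x ∨ C.coord t j x = 0 ∧ 0 < (C.coord t j).linear w

theorem eventually_pos (f : E →ᵃ[ℝ] ℝ) {x : E} (w : E) (h : 0 < f x) :
    ∀ᶠ ε in 𝓝[>] (0 : ℝ), 0 < f (x + ε • w) := by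
  have hc : Continuous fun ε : ℝ => f x + ε * f.linear w := by fun_prop
  have : ∀ᶠ ε in 𝓝 (0 : ℝ), 0 < f x + ε * f.linear w :=
    hc.continuousAt.eventually (lt_mem_nhds (by simpa using h))
  filter_upwards [nhdsWithin_le_nhds this] with ε hε
  rwa [f.apply_add_smul]

theorem StrictCone.eventually {t : ι} {x w : E} (h : C.StrictCone t x w) :
    ∀ᶠ ε in 𝓝[>] (0 : ℝ), ∀ j, 0 < C.coord t j (x + ε • w) := by
  rw [eventually_all]
  intro j
  rcases h j with h | ⟨h0, h1⟩
  · exact eventually_pos _ w h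
  · filter_upwards [self_mem_nhdsWithin] with ε hε
    rw [AffineMap.apply_add_smul, h0, zero_add]
    exact mul_pos hε h1

/-- Points close to `x` in direction `w` are interior to both triangles. This is how disjointness of
interiors enters all local arguments. -/
theorem StrictCone.eq {s t : ι} {x w : E} (hs : C.StrictCone s x w) (ht : C.StrictCone t x w) :
    s = t := by
  obtain ⟨ε, h1, h2⟩ := ((hs.eventually C).and (ht.eventually C)).exists
  exact C.eq_of_common_interior s t _ h1 h2

theorem WeakCone.pointsIn {t : ι} {x w : E} (h : C.WeakCone t x w) : C.PointsIn x w := by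
  have : ∀ᶠ ε in 𝓝[>] (0 : ℝ), ∀ j, 0 ≤ C.coord t j (x + ε • w) := by
    rw [eventually_all]
    intro j
    rcases h j with h | ⟨h0, h1⟩
    · exact (eventually_pos _ w h).mono fun _ => le_of_lt
    · filter_upwards [self_mem_nhdsWithin] with ε hε
      rw [AffineMap.apply_add_smul, h0, zero_add]
      exact mul_nonneg (le_of_lt hε) h1
  obtain ⟨ε, h1, h2⟩ := (this.and self_mem_nhdsWithin).exists
  exact ⟨ε, h2, (C.mem_region _).2 ⟨t, h1⟩⟩

theorem StrictCone.weakCone {t : ι} {x w : E} (h : C.StrictCone t x w) : C.WeakCone t x w :=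
  fun j => (h j).imp_right fun h => ⟨h.1, h.2.le⟩

/-- By convexity all points near `x` in direction `w` are in the region. If no cone contained `w`,
each triangle would miss all of these sufficiently near `x`, and finitely many triangles could not
cover them. -/
theorem exists_weakCone [Finite ι] {x w : E} (hx : x ∈ C.region) (h : C.PointsIn x w) :
    ∃ t, C.WeakCone t x w := by
  by_contra! hno
  obtain ⟨ε₀, hε₀, hmem⟩ := h
  have hev : ∀ t, ∀ᶠ ε in 𝓝[>] (0 : ℝ), ∃ j, C.coord t j (x + ε • w) < 0 := by
    intro t
    have ht := hno t
    simp only [WeakCone, not_forall, not_or, not_and, not_lt, not_le] at ht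
    obtain ⟨j, h1, h2⟩ := ht
    rcases h1.lt_or_eq with h1 | h1
    · filter_upwards [eventually_pos (-C.coord t j) w (x := x) (by simpa using h1)] with ε hε
      exact ⟨j, by simpa using hε⟩
    · filter_upwards [self_mem_nhdsWithin] with ε hε
      refine ⟨j, ?_⟩
      rw [AffineMap.apply_add_smul, h1, zero_add]
      exact mul_neg_of_pos_of_neg hε (h2 h1)
  have hle : ∀ᶠ ε in 𝓝[>] (0 : ℝ), ε ≤ ε₀ := by
    filter_upwards [Ioc_mem_nhdsGT hε₀] with ε hε using hε.2
  obtain ⟨ε, ⟨hε, hle⟩, hpos⟩ :=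
    (((eventually_all.2 hev).and hle).and self_mem_nhdsWithin).exists
  have hpos : 0 < ε := hpos
  have : x + ε • w ∈ C.region := by
    have := C.convex_region hx hmem (a := 1 - ε / ε₀) (b := ε / ε₀)
      (by rw [sub_nonneg, div_le_one hε₀]; exact hle) (by positivity) (by ring)
    convert this using 1
    rw [smul_add, smul_smul, div_mul_cancel₀ _ hε₀.ne', ← add_assoc, ← add_smul]
    simp
  obtain ⟨t, ht⟩ := (C.mem_region _).1 this
  obtain ⟨j, hj⟩ := hε t
  exact absurd (ht j) (not_le.2 hj)

theorem PointsIn.add {x v w : E} (hv : C.PointsIn x v) (hw : C.PointsIn x w) :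
    C.PointsIn x (v + w) := by
  obtain ⟨a, ha, hav⟩ := hv
  obtain ⟨b, hb, hbw⟩ := hw
  refine ⟨a * b / (a + b), by positivity, ?_⟩
  have := C.convex_region hav hbw (a := b / (a + b)) (b := a / (a + b)) (by positivity)
    (by positivity) (by field_simp; ring)
  convert this using 1
  have h1 : x = (b / (a + b)) • x + (a / (a + b)) • x := by
    rw [← add_smul, ← add_div, add_comm b a, div_self (by positivity), one_smul]
  conv_lhs => rw [h1]
  module

theorem PointsIn.smul {x w : E} (hw : C.PointsIn x w) {c : ℝ} (hc : 0 < c) :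
    C.PointsIn x (c • w) := by
  obtain ⟨a, ha, haw⟩ := hw
  refine ⟨a / c, by positivity, ?_⟩
  rwa [smul_smul, div_mul_cancel₀ _ hc.ne']

theorem pointsIn_sub {x y : E} (hy : y ∈ C.region) : C.PointsIn x (y - x) :=
  ⟨1, one_pos, by simpa using hy⟩

/-! ### Barycentric coordinates of a triangle -/

theorem vert_mem (t : ι) (j : Fin 3) : C.vert t j ∈ C.region := by
  refine (C.mem_region _).2 ⟨t, fun k => ?_⟩
  by_cases h : k = j
  · rw [h, C.coord_self]; exact zero_le_one
  · rw [C.coord_ne _ _ _ h]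

theorem vert_injective (t : ι) : Function.Injective (C.vert t) := by
  intro a b h
  by_contra hab
  have := C.coord_ne t a b hab
  rw [← h, C.coord_self] at this
  exact one_ne_zero this

theorem ψ_vert_ne (t : ι) {a b : Fin 3} (h : a ≠ b) : C.ψ (C.vert t a) ≠ C.ψ (C.vert t b) :=
  fun hab => h (C.vert_injective t (C.ψ_inj _ _ _ _ hab))

theorem sum_coord_linear (t : ι) (w : E) : ∑ j, (C.coord t j).linear w = 0 := by
  have h1 := C.sum_coord t (0 + (1 : ℝ) • w)
  simp only [AffineMap.apply_add_smul, Finset.sum_add_distrib, C.sum_coord, one_mul] at h1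
  linarith

theorem ψ_eq_sum (t : ι) (x : E) : C.ψ x = ∑ j, C.coord t j x * C.ψ (C.vert t j) := by
  conv_lhs => rw [← C.sum_coord_smul t x]
  simp

/-- No side is parallel to `u`. -/
theorem linear_u_ne (t : ι) (j : Fin 3) : (C.coord t j).linear C.u ≠ 0 := by
  intro h
  obtain ⟨a, b, hja, hjb, hab⟩ := Fin.exists_other_two j
  have hψ : C.ψ (C.vert t b - C.vert t a) ≠ 0 := by
    rw [map_sub, sub_ne_zero]; exact C.ψ_vert_ne t hab.symm
  set v := C.vert t j - C.vert t a
  set d := C.vert t b - C.vert t a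
  -- Subtracting a multiple of the side vector `d` moves `v` into the kernel, so `v` is a
  -- combination of `d` and `u`; the coordinate would vanish on both, yet it is 1 on `v`.
  obtain ⟨c, hc⟩ := C.ker_ψ (v - (C.ψ v / C.ψ d) • d) (by simp [hψ])
  have hd : (C.coord t j).linear d = 0 := by
    rw [AffineMap.linear_sub_apply, C.coord_ne _ _ _ hjb, C.coord_ne _ _ _ hja, sub_zero]
  have hv : (C.coord t j).linear v = 1 := by
    rw [AffineMap.linear_sub_apply, C.coord_self, C.coord_ne _ _ _ hja, sub_zero]
  have := congrArg (C.coord t j).linear hc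
  simp [hd, hv, h] at this

theorem eq_of_coord_eq_zero {t : ι} {j : Fin 3} {x y : E} (hx : C.coord t j x = 0)
    (hy : C.coord t j y = 0) (h : C.ψ x = C.ψ y) : x = y := by
  obtain ⟨c, hc⟩ := C.ker_ψ (x - y) (by simp [h])
  have := (C.coord t j).linear_sub_apply x y
  rw [hc, hx, hy, map_smul, smul_eq_mul, sub_zero] at this
  rcases mul_eq_zero.1 this with h | h
  · rwa [h, zero_smul, sub_eq_zero] at hc
  · exact absurd h (C.linear_u_ne t j)

theorem eq_vert_of_coord_eq_zero {t : ι} {j a b : Fin 3} (hja : j ≠ a) (hjb : j ≠ b) (hab : a ≠ b)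
    {x : E} (ha : C.coord t a x = 0) (hb : C.coord t b x = 0) : x = C.vert t j := by
  have h1 := C.sum_coord t x
  have h2 := C.sum_coord_smul t x
  rw [Fin.sum_eq_of_distinct _ hja hjb hab] at h1 h2
  rw [ha, hb] at h1 h2
  simp only [add_zero] at h1
  simpa [h1] using h2.symm

/-- Every vertex of a triangle has a direction pointing into its interior and avoiding the zero set
of a given nonzero functional. -/
theorem exists_strictCone_vert (t : ι) (k : Fin 3) (f : E →ₗ[ℝ] ℝ) (hf : f ≠ 0) :
    ∃ w, C.StrictCone t (C.vert t k) w ∧ f w ≠ 0 := by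
  obtain ⟨a, b, hka, hkb, hab⟩ := Fin.exists_other_two k
  set v := C.vert t a - C.vert t k with hv
  set w := C.vert t b - C.vert t k with hw
  have key : ∀ p q : ℝ, 0 < p → 0 < q → C.StrictCone t (C.vert t k) (p • v + q • w) := by
    intro p q hp hq i
    rcases Fin.eq_or_eq_or_eq hka hkb hab i with rfl | rfl | rfl
    · left; rw [C.coord_self]; exact one_pos
    · right
      refine ⟨C.coord_ne _ _ _ hka.symm, ?_⟩
      simp [hv, hw, AffineMap.linear_sub_apply, C.coord_self, C.coord_ne _ _ _ hka.symm,
        C.coord_ne _ _ _ hab, -map_sub, hp]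
    · right
      refine ⟨C.coord_ne _ _ _ hkb.symm, ?_⟩
      simp [hv, hw, AffineMap.linear_sub_apply, C.coord_self, C.coord_ne _ _ _ hkb.symm,
        C.coord_ne _ _ _ hab.symm, -map_sub, hq]
  -- Vanishing at both `v + w` and `v + 2w` forces `f` to vanish on the edge vectors `v` and `w`;
  -- expanding the origin then gives `f = 0` at the vertex as well.
  by_contra! hno
  have h1 := hno _ (key 1 1 one_pos one_pos)
  have h2 := hno _ (key 1 2 one_pos two_pos)
  simp only [map_add, map_smul, smul_eq_mul] at h1 h2
  have hfv : f v = 0 := by linarith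
  have hfw : f w = 0 := by linarith
  apply hf
  ext x
  have hx : x = C.coord t a x • v + C.coord t b x • w + C.vert t k := by
    have h1 := C.sum_coord t x
    have h2 := C.sum_coord_smul t x
    rw [Fin.sum_eq_of_distinct _ hka hkb hab] at h1 h2
    have h3 : C.coord t k x = 1 - (C.coord t a x + C.coord t b x) := by linarith
    conv_lhs => rw [← h2, h3]
    rw [hv, hw]; module
  have h0 : (0 : E) = C.coord t a 0 • v + C.coord t b 0 • w + C.vert t k := by
    have h1 := C.sum_coord t 0
    have h2 := C.sum_coord_smul t 0
    rw [Fin.sum_eq_of_distinct _ hka hkb hab] at h1 h2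
    have h3 : C.coord t k 0 = 1 - (C.coord t a 0 + C.coord t b 0) := by linarith
    conv_lhs => rw [← h2, h3]
    rw [hv, hw]; module
  have h4 := congrArg f h0
  simp only [map_add, map_smul, smul_eq_mul, hfv, hfw, map_zero] at h4
  rw [hx]
  simp only [map_add, map_smul, smul_eq_mul, hfv, hfw, LinearMap.zero_apply]
  linarith

theorem WeakCone.linear_pos {t : ι} {j k : Fin 3} (hk : k ≠ j) {σ : ℝ} (hσ : σ ≠ 0)
    (h : C.WeakCone t (C.vert t j) (σ • C.u)) : 0 < (C.coord t k).linear (σ • C.u) := by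
  have h := (h k).resolve_left (by rw [C.coord_ne _ _ _ hk]; exact lt_irrefl _)
  refine lt_of_le_of_ne h.2 ?_
  rw [map_smul, smul_eq_mul]
  exact (mul_ne_zero hσ (C.linear_u_ne t k)).symm

theorem pointsIn_of_smul_u {x : E} {c : ℝ} (hc : c ≠ 0) (h : C.PointsIn x (c • C.u)) :
    C.PointsIn x ((1 : ℝ) • C.u) ∨ C.PointsIn x ((-1 : ℝ) • C.u) := by
  rcases hc.lt_or_gt with hc | hc
  · right
    have := h.smul C (c := -c⁻¹) (by rw [neg_pos]; exact inv_lt_zero.2 hc)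
    rwa [smul_smul, neg_mul, inv_mul_cancel₀ hc.ne] at this
  · left
    have := h.smul C (inv_pos.2 hc)
    rwa [smul_smul, inv_mul_cancel₀ hc.ne'] at this

/-- The positive combination of `y - x` and `z - x` killed by `ψ` points into the region and is a
multiple of `u`. Both vertical directions being blocked, it is zero, so the three points are
collinear. -/
theorem smul_sub_eq_of_blocked {x y z : E} (h1 : ¬ C.PointsIn x ((1 : ℝ) • C.u))
    (h2 : ¬ C.PointsIn x ((-1 : ℝ) • C.u)) (hy : y ∈ C.region) (hz : z ∈ C.region)
    (hyx : C.ψ y < C.ψ x) (hxz : C.ψ x < C.ψ z) :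
    (∃ c : ℝ, z - x = c • (y - x)) ∧ ∃ c : ℝ, y - x = c • (z - x) := by
  have hin : C.PointsIn x ((C.ψ z - C.ψ x) • (y - x) + (C.ψ x - C.ψ y) • (z - x)) :=
    ((C.pointsIn_sub hy).smul C (sub_pos.2 hxz)).add C ((C.pointsIn_sub hz).smul C (sub_pos.2 hyx))
  obtain ⟨c, hc⟩ := C.ker_ψ ((C.ψ z - C.ψ x) • (y - x) + (C.ψ x - C.ψ y) • (z - x)) (by
    simp only [map_add, map_smul, map_sub, smul_eq_mul]; ring)
  have hc0 : c = 0 := by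
    by_contra hne
    rw [hc] at hin
    rcases C.pointsIn_of_smul_u hne hin with h | h
    exacts [h1 h, h2 h]
  rw [hc0, zero_smul] at hc
  have ha : C.ψ z - C.ψ x ≠ 0 := (sub_pos.2 hxz).ne'
  have hb : C.ψ x - C.ψ y ≠ 0 := (sub_pos.2 hyx).ne'
  constructor
  · refine ⟨-((C.ψ x - C.ψ y)⁻¹ * (C.ψ z - C.ψ x)), ?_⟩
    have := eq_neg_of_add_eq_zero_right hc
    rw [neg_smul, mul_smul, ← smul_neg, ← this, smul_smul, inv_mul_cancel₀ hb, one_smul]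
  · refine ⟨-((C.ψ z - C.ψ x)⁻¹ * (C.ψ x - C.ψ y)), ?_⟩
    have := eq_neg_of_add_eq_zero_left hc
    rw [neg_smul, mul_smul, ← smul_neg, ← this, smul_smul, inv_mul_cancel₀ ha, one_smul]

theorem eq_zero_of_mem_extremePoints {x w : E} (hx : x ∈ C.region.extremePoints ℝ)
    (h1 : C.PointsIn x w) (h2 : C.PointsIn x (-w)) : w = 0 := by
  obtain ⟨a, ha, hav⟩ := h1
  obtain ⟨b, hb, hbw⟩ := h2
  have hseg : x ∈ openSegment ℝ (x + a • w) (x + b • -w) := by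
    refine ⟨b / (a + b), a / (a + b), by positivity, by positivity, by field_simp; ring, ?_⟩
    have h1 : x = (b / (a + b)) • x + (a / (a + b)) • x := by
      rw [← add_smul, ← add_div, add_comm b a, div_self (by positivity), one_smul]
    conv_rhs => rw [h1]
    module
  have := hx.2 hav hbw hseg
  rw [add_eq_left, smul_eq_zero, or_iff_right ha.ne'] at this
  exact this

/-! ### Sides -/

/-- `x` lies in the relative interior of the side of `t` opposite to the vertex `j`. -/
def OnSide (t : ι) (j : Fin 3) (x : E) : Prop :=
  C.coord t j x = 0 ∧ ∀ k, k ≠ j → 0 < C.coord t k x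

theorem OnSide.strictCone {t : ι} {j : Fin 3} {x w : E} (h : C.OnSide t j x)
    (hw : 0 < (C.coord t j).linear w) : C.StrictCone t x w := by
  intro k
  by_cases hk : k = j
  · subst hk; exact Or.inr ⟨h.1, hw⟩
  · exact Or.inl (h.2 k hk)

theorem OnSide.weakCone {t : ι} {j : Fin 3} {x w : E} (h : C.OnSide t j x)
    (hw : 0 ≤ (C.coord t j).linear w) : C.WeakCone t x w := by
  intro k
  by_cases hk : k = j
  · subst hk; exact Or.inr ⟨h.1, hw⟩
  · exact Or.inl (h.2 k hk)

theorem OnSide.mem_region {t : ι} {j : Fin 3} {x : E} (h : C.OnSide t j x) : x ∈ C.region := by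
  refine (C.mem_region x).2 ⟨t, fun k => ?_⟩
  by_cases hk : k = j
  · rw [hk, h.1]
  · exact (h.2 k hk).le

theorem OnSide.ne_of_vert {s t : ι} {j k : Fin 3} (h : C.OnSide t j (C.vert s k)) : s ≠ t := by
  rintro rfl
  by_cases hjk : j = k
  · have := h.1
    rw [hjk, C.coord_self] at this
    exact one_ne_zero this
  · have hthird : ∀ a b : Fin 3, ∃ i, i ≠ a ∧ i ≠ b := by decide
    obtain ⟨i, hij, hik⟩ := hthird j k
    have := h.2 i hij
    rw [C.coord_ne _ _ _ hik] at this
    exact lt_irrefl _ this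

theorem OnSide.linear_vert_sub {t : ι} {j : Fin 3} {x : E} (h : C.OnSide t j x) :
    (C.coord t j).linear (C.vert t j - x) = 1 := by
  rw [AffineMap.linear_sub_apply, C.coord_self, h.1, sub_zero]

theorem linear_ne_zero (t : ι) (j : Fin 3) : (C.coord t j).linear ≠ 0 :=
  fun h => C.linear_u_ne t j (by rw [h]; rfl)

/-- Sides of different triangles whose relative interiors meet lie on a common line, with the
triangles on opposite sides of it. -/
theorem OnSide.exists_coord_eq_neg {s t : ι} {i j : Fin 3} {x : E} (ht : C.OnSide t j x)
    (hs : C.OnSide s i x) (hst : s ≠ t) :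
    ∃ c : ℝ, 0 < c ∧ ∀ y, C.coord s i y = -c * C.coord t j y := by
  set a := (C.coord t j).linear with ha
  set b := (C.coord s i).linear with hb
  have hno : ∀ w, 0 < a w → b w ≤ 0 := fun w h1 => by
    by_contra! h2
    exact hst ((hs.strictCone C h2).eq C (ht.strictCone C h1))
  set w₀ := C.vert t j - x
  have hw₀ : a w₀ = 1 := ht.linear_vert_sub C
  have hker : ∀ v, a v = 0 → b v = 0 := by
    intro v hv
    by_contra hbv
    -- The coefficient makes both `a` and `b` equal to 1 on this vector, so it would enter both
    -- triangles.
    have := hno (w₀ + ((1 - b w₀) / b v) • v) (by simp [hw₀, hv])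
    simp only [map_add, map_smul, smul_eq_mul, div_mul_cancel₀ _ hbv] at this
    linarith
  have hprop : ∀ v, b v = b w₀ * a v := by
    intro v
    have := hker (v - a v • w₀) (by simp [hw₀])
    simp only [map_sub, map_smul, smul_eq_mul] at this
    linarith
  have hle := hno w₀ (by rw [hw₀]; exact one_pos)
  have hne : b w₀ ≠ 0 := fun h0 => C.linear_ne_zero s i (by
    ext v; rw [← hb, hprop, h0, zero_mul]; rfl)
  refine ⟨-b w₀, by rcases hle.lt_or_eq with h | h; linarith; exact absurd h hne, fun y => ?_⟩
  have h1 := (C.coord s i).linear_sub_apply y x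
  have h2 := (C.coord t j).linear_sub_apply y x
  rw [hs.1] at h1
  rw [ht.1] at h2
  have := hprop (y - x)
  rw [← hb] at h1
  rw [← ha] at h2
  rw [h1, h2] at this
  linarith

theorem linear_eq_of_coord_eq {s t : ι} {i j : Fin 3} {c : ℝ}
    (h : ∀ y, C.coord s i y = c * C.coord t j y) (w : E) :
    (C.coord s i).linear w = c * (C.coord t j).linear w := by
  have h1 := (C.coord s i).linear_sub_apply w 0
  have h2 := (C.coord t j).linear_sub_apply w 0
  rw [sub_zero] at h1 h2
  rw [h1, h2, h, h]; ring

/-- A relatively interior point of sides on which `u` points to the same side determines the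
triangle and its side. -/
theorem OnSide.unique {s t : ι} {i j : Fin 3} {x : E} (ht : C.OnSide t j x) (hs : C.OnSide s i x)
    (h : 0 < (C.coord t j).linear C.u ↔ 0 < (C.coord s i).linear C.u) : (t, j) = (s, i) := by
  by_cases hst : s = t
  · subst hst
    by_contra hne
    have hij : j ≠ i := fun h => hne (by rw [h])
    have := hs.2 j hij
    rw [ht.1] at this
    exact lt_irrefl _ this
  · obtain ⟨c, hc, hcoord⟩ := ht.exists_coord_eq_neg C hs hst
    have h1 := C.linear_eq_of_coord_eq hcoord C.u
    have h2 := C.linear_u_ne t j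
    exfalso
    rcases h2.lt_or_gt with h2 | h2
    · have : 0 < (C.coord s i).linear C.u := by rw [h1]; nlinarith
      exact absurd (h.2 this) (not_lt.2 h2.le)
    · have := h.1 h2
      rw [h1] at this
      nlinarith

/-- All directions at an interior point of `t` enter `t`, including one that enters the vertex's own
triangle `s`; so `s = t`, whose vertices have vanishing coordinates. -/
theorem vert_not_interior (t : ι) (s : ι) (k : Fin 3) : ¬ ∀ j, 0 < C.coord t j (C.vert s k) := by
  intro h
  obtain ⟨w, hw, -⟩ := C.exists_strictCone_vert s k _ (C.linear_ne_zero s k)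
  obtain rfl : s = t := hw.eq C fun j => Or.inl (h j)
  obtain ⟨a, _, hka, -, -⟩ := Fin.exists_other_two k
  have := h a
  rw [C.coord_ne _ _ _ hka.symm] at this
  exact lt_irrefl _ this

/-- A point of a closed triangle is interior, relatively interior to a side, or a vertex. -/
theorem trichotomy {t : ι} {x : E} (h : ∀ j, 0 ≤ C.coord t j x) :
    (∀ j, 0 < C.coord t j x) ∨ (∃ j, C.OnSide t j x) ∨ ∃ j, x = C.vert t j := by
  by_cases h0 : ∀ j, 0 < C.coord t j x
  · exact Or.inl h0
  right
  push Not at h0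
  obtain ⟨a, ha⟩ := h0
  have ha := le_antisymm ha (h a)
  by_cases h1 : ∀ k, k ≠ a → 0 < C.coord t k x
  · exact Or.inl ⟨a, ha, h1⟩
  right
  push Not at h1
  obtain ⟨b, hba, hb⟩ := h1
  have hb := le_antisymm hb (h b)
  have hthird : ∀ a b : Fin 3, ∃ j, j ≠ a ∧ j ≠ b := by decide
  obtain ⟨j, hja, hjb⟩ := hthird a b
  exact ⟨j, C.eq_vert_of_coord_eq_zero hja hjb hba.symm ha hb⟩

/-! ### Sides as intervals of `ψ`-values -/

/-- Index of the endpoint with larger `ψ` of the side opposite to the vertex `j`. -/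
noncomputable def rightIdx (t : ι) (j : Fin 3) : Fin 3 :=
  if C.ψ (C.vert t (j + 1)) ≤ C.ψ (C.vert t (j + 2)) then j + 2 else j + 1

/-- Index of the endpoint with smaller `ψ` of the side opposite to the vertex `j`. -/
noncomputable def leftIdx (t : ι) (j : Fin 3) : Fin 3 :=
  if C.ψ (C.vert t (j + 1)) ≤ C.ψ (C.vert t (j + 2)) then j + 1 else j + 2

/-- The endpoint with larger `ψ` of a side. -/
noncomputable def right (t : ι) (j : Fin 3) : E := C.vert t (C.rightIdx t j)

/-- The endpoint with smaller `ψ` of a side. -/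
noncomputable def left (t : ι) (j : Fin 3) : E := C.vert t (C.leftIdx t j)

theorem idx_distinct (t : ι) (j : Fin 3) :
    j ≠ C.leftIdx t j ∧ j ≠ C.rightIdx t j ∧ C.leftIdx t j ≠ C.rightIdx t j := by
  unfold leftIdx rightIdx
  have h12 : ∀ j : Fin 3, j ≠ j + 1 ∧ j ≠ j + 2 ∧ j + 1 ≠ j + 2 := by decide
  obtain ⟨h1, h2, h3⟩ := h12 j
  split_ifs
  exacts [⟨h1, h2, h3⟩, ⟨h2, h1, h3.symm⟩]

theorem ψ_left_lt_right (t : ι) (j : Fin 3) : C.ψ (C.left t j) < C.ψ (C.right t j) := by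
  have h := C.ψ_vert_ne t (C.idx_distinct t j).2.2
  refine lt_of_le_of_ne ?_ h
  unfold left right leftIdx rightIdx
  split_ifs with h
  · exact h
  · exact (not_le.1 h).le

theorem coord_left (t : ι) (j : Fin 3) : C.coord t j (C.left t j) = 0 :=
  C.coord_ne _ _ _ (C.idx_distinct t j).1

theorem coord_right (t : ι) (j : Fin 3) : C.coord t j (C.right t j) = 0 :=
  C.coord_ne _ _ _ (C.idx_distinct t j).2.1

/-- On the line of the side, the value of `ψ` is the average of its endpoint values weighted by the
two other coordinates. Overlaps of collinear sides thus become overlaps of real intervals. -/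
theorem onSide_iff {t : ι} {j : Fin 3} {x : E} :
    C.OnSide t j x ↔
      C.coord t j x = 0 ∧ C.ψ (C.left t j) < C.ψ x ∧ C.ψ x < C.ψ (C.right t j) := by
  obtain ⟨h1, h2, h3⟩ := C.idx_distinct t j
  have hlt := C.ψ_left_lt_right t j
  unfold OnSide
  refine and_congr_right fun h0 => ?_
  have hs := C.sum_coord t x
  have hψ := C.ψ_eq_sum t x
  rw [Fin.sum_eq_of_distinct _ h1 h2 h3, h0] at hs hψ
  change C.ψ x = 0 * _ + (_ * C.ψ (C.left t j) + _ * C.ψ (C.right t j)) at hψ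
  set l := C.coord t (C.leftIdx t j) x
  set r := C.coord t (C.rightIdx t j) x
  have hl : l = 1 - r := by linarith
  have e1 : C.ψ x - C.ψ (C.left t j) = r * (C.ψ (C.right t j) - C.ψ (C.left t j)) := by
    rw [hψ, hl]; ring
  have e2 : C.ψ (C.right t j) - C.ψ x = l * (C.ψ (C.right t j) - C.ψ (C.left t j)) := by
    rw [hψ, hl]; ring
  have hd : 0 < C.ψ (C.right t j) - C.ψ (C.left t j) := sub_pos.2 hlt
  constructor
  · intro h
    have p1 : 0 < r := h _ h2.symm
    have p2 : 0 < l := h _ h1.symm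
    have := mul_pos p1 hd
    have := mul_pos p2 hd
    constructor <;> linarith
  · rintro ⟨ha, hb⟩ k hk
    rcases Fin.eq_or_eq_or_eq h1 h2 h3 k with rfl | rfl | rfl
    · exact absurd rfl hk
    · exact pos_of_mul_pos_left (by rw [← e2]; linarith) hd.le
    · exact pos_of_mul_pos_left (by rw [← e1]; linarith) hd.le

theorem exists_coord_eq_zero (t : ι) (j : Fin 3) (c : ℝ) :
    ∃ x, C.coord t j x = 0 ∧ C.ψ x = c := by
  have h := C.ψ_left_lt_right t j
  have hne : C.ψ (C.right t j) - C.ψ (C.left t j) ≠ 0 := (sub_pos.2 h).ne'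
  refine ⟨C.left t j + ((c - C.ψ (C.left t j)) / (C.ψ (C.right t j) - C.ψ (C.left t j))) •
    (C.right t j - C.left t j), ?_, ?_⟩
  · rw [AffineMap.apply_add_smul, AffineMap.linear_sub_apply, coord_left, coord_right]; ring
  · simp only [map_add, map_smul, map_sub, smul_eq_mul, div_mul_cancel₀ _ hne]; ring

end GenericTiling

namespace GenericTiling

variable {ι E : Type*} [AddCommGroup E] [Module ℝ E] (C : GenericTiling ι E)

/-! ### The sides not on the boundary -/

/-- The sides `e` and `f` lie on a common line, with their triangles on different sides of it. -/
def Opposite (e f : ι × Fin 3) : Prop :=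
  ∃ c : ℝ, 0 < c ∧ ∀ y, C.coord f.1 f.2 y = -c * C.coord e.1 e.2 y

theorem Opposite.coord_eq_zero_iff {e f : ι × Fin 3} (h : C.Opposite e f) (y : E) :
    C.coord f.1 f.2 y = 0 ↔ C.coord e.1 e.2 y = 0 := by
  obtain ⟨c, hc, h⟩ := h
  rw [h, mul_eq_zero, neg_eq_zero, or_iff_right hc.ne']

theorem Opposite.linear_u_pos_iff {e f : ι × Fin 3} (h : C.Opposite e f) :
    0 < (C.coord e.1 e.2).linear C.u ↔ ¬ 0 < (C.coord f.1 f.2).linear C.u := by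
  obtain ⟨c, hc, h⟩ := h
  have h1 := C.linear_eq_of_coord_eq h C.u
  rcases (C.linear_u_ne e.1 e.2).lt_or_gt with h2 | h2
  · have : 0 < (C.coord f.1 f.2).linear C.u := by rw [h1]; nlinarith
    exact iff_of_false h2.not_gt (not_not.2 this)
  · refine iff_of_true h2 (not_lt.2 ?_)
    rw [h1]; nlinarith

/-- Two sides opposite to the same side coincide as soon as they overlap. -/
theorem Opposite.unique {e e' f : ι × Fin 3} (h : C.Opposite e f) (h' : C.Opposite e' f)
    (hlt : max (C.ψ (C.left e.1 e.2)) (C.ψ (C.left e'.1 e'.2)) <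
      min (C.ψ (C.right e.1 e.2)) (C.ψ (C.right e'.1 e'.2))) : e = e' := by
  obtain ⟨c, hc1, hc2⟩ := exists_between hlt
  obtain ⟨x, hx, rfl⟩ := C.exists_coord_eq_zero e.1 e.2 c
  have hx' := (h'.coord_eq_zero_iff C x).1 ((h.coord_eq_zero_iff C x).2 hx)
  rw [max_lt_iff] at hc1
  rw [lt_min_iff] at hc2
  exact OnSide.unique C (C.onSide_iff.2 ⟨hx, hc1.1, hc2.1⟩) (C.onSide_iff.2 ⟨hx', hc1.2, hc2.2⟩)
    ((h.linear_u_pos_iff C).trans (h'.linear_u_pos_iff C).symm)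

theorem Opposite.unique_of_right_eq {e e' f : ι × Fin 3} (h : C.Opposite e f)
    (h' : C.Opposite e' f) (hr : C.right e.1 e.2 = C.right e'.1 e'.2) : e = e' := by
  refine h.unique C h' ?_
  have h1 := C.ψ_left_lt_right e.1 e.2
  have h2 := C.ψ_left_lt_right e'.1 e'.2
  rw [← hr, min_self, max_lt_iff]
  exact ⟨h1, by rwa [hr]⟩

theorem Opposite.unique_of_left_eq {e e' f : ι × Fin 3} (h : C.Opposite e f)
    (h' : C.Opposite e' f) (hl : C.left e.1 e.2 = C.left e'.1 e'.2) : e = e' := by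
  refine h.unique C h' ?_
  have h1 := C.ψ_left_lt_right e.1 e.2
  have h2 := C.ψ_left_lt_right e'.1 e'.2
  rw [← hl, max_self, lt_min_iff]
  exact ⟨h1, by rwa [hl]⟩

variable [Fintype ι]

open Classical in
/-- The set of all vertices. -/
noncomputable def verts : Finset E :=
  Finset.univ.image fun e : ι × Fin 3 => C.vert e.1 e.2

theorem mem_verts {x : E} : x ∈ C.verts ↔ ∃ t j, x = C.vert t j := by
  simp [verts, eq_comm]

theorem vert_mem_verts (t : ι) (j : Fin 3) : C.vert t j ∈ C.verts := C.mem_verts.2 ⟨t, j, rfl⟩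

theorem mem_region_of_mem_verts {x : E} (hx : x ∈ C.verts) : x ∈ C.region := by
  obtain ⟨t, j, rfl⟩ := C.mem_verts.1 hx
  exact C.vert_mem t j

theorem ψ_injOn : Set.InjOn C.ψ C.verts := by
  intro x hx y hy h
  obtain ⟨t, j, rfl⟩ := C.mem_verts.1 hx
  obtain ⟨s, i, rfl⟩ := C.mem_verts.1 hy
  exact C.ψ_inj _ _ _ _ h

/-- Next to its right endpoint, a side not on the boundary borders on an opposite side. -/
theorem exists_opposite {t : ι} {j : Fin 3} (h : ∃ p ∈ C.region, C.coord t j p < 0) :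
    ∃ s i, s ≠ t ∧ C.Opposite (t, j) (s, i) ∧ C.ψ (C.right t j) ≤ C.ψ (C.right s i) ∧
      C.ψ (C.left s i) < C.ψ (C.right t j) := by
  obtain ⟨p, hp, hneg⟩ := h
  -- `v₀` is the last vertex before the right endpoint in the order of `ψ`. The point `m` is taken
  -- on the side beyond it, so no vertex has a `ψ`-value in the interval from `m` up to, but
  -- excluding, the right endpoint.
  obtain ⟨v₀, hv₀, hmax⟩ := (C.verts.filter fun v => C.ψ v < C.ψ (C.right t j)).exists_max_image
    C.ψ ⟨C.left t j, by simp [left, vert_mem_verts]; exact C.ψ_left_lt_right t j⟩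
  rw [Finset.mem_filter] at hv₀
  obtain ⟨c, hc1, hc2⟩ := exists_between hv₀.2
  obtain ⟨m, hm, rfl⟩ := C.exists_coord_eq_zero t j c
  have hgap : ∀ v ∈ C.verts, C.ψ v < C.ψ (C.right t j) → C.ψ v < C.ψ m := fun v hv hlt =>
    (hmax v (Finset.mem_filter.2 ⟨hv, hlt⟩)).trans_lt hc1
  have hmt : C.OnSide t j m := C.onSide_iff.2
    ⟨hm, hgap _ (C.vert_mem_verts _ _) (C.ψ_left_lt_right t j), hc2⟩
  -- The direction to `p` leaves `t` across the side, so the triangle `s` it enters is a different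
  -- one.
  obtain ⟨s, hs⟩ := C.exists_weakCone (hmt.mem_region C) (C.pointsIn_sub (x := m) hp)
  have hlin : (C.coord t j).linear (p - m) < 0 := by
    rw [AffineMap.linear_sub_apply, hm, sub_zero]; exact hneg
  have hst : s ≠ t := by
    rintro rfl
    rcases hs j with h | h
    · rw [hm] at h; exact lt_irrefl _ h
    · exact absurd h.2 (not_le.2 hlin)
  have hms : ∀ k, 0 ≤ C.coord s k m := fun k => (hs k).elim le_of_lt fun h => h.1.ge
  rcases C.trichotomy hms with h | ⟨i, hi⟩ | ⟨i, rfl⟩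
  · have : C.StrictCone t m (C.vert t j - m) :=
      hmt.strictCone C (by rw [hmt.linear_vert_sub C]; exact one_pos)
    exact absurd (StrictCone.eq C (fun k => Or.inl (h k)) this) hst
  · have hi' := C.onSide_iff.1 hi
    refine ⟨s, i, hst, hmt.exists_coord_eq_neg C hi hst, ?_, hi'.2.1.trans hc2⟩
    by_contra! hlt
    exact absurd (hgap _ (C.vert_mem_verts _ _) hlt) hi'.2.2.not_gt
  · exact absurd (hgap _ (C.vert_mem_verts s i) hc2) (lt_irrefl _)

open Classical in
/-- Pairs of a side and a vertex in its relative interior. -/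
noncomputable def incidences : Finset ((ι × Fin 3) × E) :=
  (Finset.univ ×ˢ C.verts).filter fun q => C.OnSide q.1.1 q.1.2 q.2

theorem mem_incidences {f : ι × Fin 3} {x : E} :
    (f, x) ∈ C.incidences ↔ x ∈ C.verts ∧ C.OnSide f.1 f.2 x := by
  simp [incidences]

open Classical in
/-- The sides not on the boundary of the region. -/
noncomputable def innerSides : Finset (ι × Fin 3) :=
  Finset.univ.filter fun e => ∃ p ∈ C.region, C.coord e.1 e.2 p < 0

open Classical in
-- Compare an inner side e with the opposite side f at its right end. Unless they coincide, the
-- right end of e is inside f (`A`), the left end of e is inside f (`A'`), or the left end of f is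
-- inside e (`B`). Each class has at most I members: in the first two, f and the endpoint determine
-- e, since sides opposite to f do not overlap; in the third, e is the side of the incidence.
theorem card_innerSides_le
    (hns : ∀ s t i j, s ≠ t → C.left s i = C.left t j → C.right s i = C.right t j → False) :
    C.innerSides.card ≤ 3 * C.incidences.card := by
  let A : Finset (ι × Fin 3) := Finset.univ.filter fun e =>
    ∃ f, C.Opposite e f ∧ C.OnSide f.1 f.2 (C.right e.1 e.2)
  let A' : Finset (ι × Fin 3) := Finset.univ.filter fun e =>
    ∃ f, C.Opposite e f ∧ C.OnSide f.1 f.2 (C.left e.1 e.2)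
  let B : Finset (ι × Fin 3) := Finset.univ.filter fun e =>
    ∃ x ∈ C.verts, C.OnSide e.1 e.2 x
  have hsub : C.innerSides ⊆ A ∪ A' ∪ B := by
    rintro ⟨t, j⟩ he
    obtain ⟨s, i, hst, hopp, hr, hl⟩ := C.exists_opposite (Finset.mem_filter.1 he).2
    have hz := hopp.coord_eq_zero_iff C
    simp only [A, A', B, Finset.mem_union, Finset.mem_filter, Finset.mem_univ, true_and]
    rcases hr.lt_or_eq with hr | hr
    · exact Or.inl (Or.inl ⟨(s, i), hopp, C.onSide_iff.2 ⟨(hz _).2 (C.coord_right t j), hl, hr⟩⟩)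
    have hr' := C.eq_of_coord_eq_zero (C.coord_right t j) ((hz _).1 (C.coord_right s i)) hr
    rcases lt_trichotomy (C.ψ (C.left t j)) (C.ψ (C.left s i)) with h | h | h
    · exact Or.inr ⟨C.left s i, C.vert_mem_verts _ _,
        C.onSide_iff.2 ⟨(hz _).1 (C.coord_left s i), h, hl⟩⟩
    · exact (hns s t i j hst (C.eq_of_coord_eq_zero (C.coord_left t j)
        ((hz _).1 (C.coord_left s i)) h).symm hr'.symm).elim
    · refine Or.inl (Or.inr ⟨(s, i), hopp, C.onSide_iff.2 ⟨(hz _).2 (C.coord_left t j), h, ?_⟩⟩)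
      rw [← hr]; exact C.ψ_left_lt_right t j
  have hA : A.card ≤ C.incidences.card := by
    refine Finset.card_le_card_of_forall_subsingleton
      (fun e q => C.Opposite e q.1 ∧ q.2 = C.right e.1 e.2) (fun e he => ?_) ?_
    · obtain ⟨f, hf, hon⟩ := (Finset.mem_filter.1 he).2
      exact ⟨(f, _), C.mem_incidences.2 ⟨C.vert_mem_verts _ _, hon⟩, hf, rfl⟩
    · rintro q - e ⟨-, he, he'⟩ e' ⟨-, hf, hf'⟩
      exact he.unique_of_right_eq C hf (he'.symm.trans hf')
  have hA' : A'.card ≤ C.incidences.card := by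
    refine Finset.card_le_card_of_forall_subsingleton
      (fun e q => C.Opposite e q.1 ∧ q.2 = C.left e.1 e.2) (fun e he => ?_) ?_
    · obtain ⟨f, hf, hon⟩ := (Finset.mem_filter.1 he).2
      exact ⟨(f, _), C.mem_incidences.2 ⟨C.vert_mem_verts _ _, hon⟩, hf, rfl⟩
    · rintro q - e ⟨-, he, he'⟩ e' ⟨-, hf, hf'⟩
      exact he.unique_of_left_eq C hf (he'.symm.trans hf')
  have hB : B.card ≤ C.incidences.card := by
    refine Finset.card_le_card_of_forall_subsingleton (fun e q => e = q.1) (fun e he => ?_) ?_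
    · obtain ⟨x, hx, hon⟩ := (Finset.mem_filter.1 he).2
      exact ⟨(e, x), C.mem_incidences.2 ⟨hx, hon⟩, rfl⟩
    · rintro q - e ⟨-, he⟩ e' ⟨-, he'⟩
      exact he.trans he'.symm
  have h1 := Finset.card_le_card hsub
  have h2 := Finset.card_union_le (A ∪ A') B
  have h3 := Finset.card_union_le A A'
  omega

/-! ### The sides on the boundary -/

open Classical in
/-- The sides on the boundary of the region. -/
noncomputable def outerSides : Finset (ι × Fin 3) :=
  Finset.univ.filter fun e => ∀ p ∈ C.region, 0 ≤ C.coord e.1 e.2 p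

theorem card_innerSides_add_card_outerSides :
    C.innerSides.card + C.outerSides.card = 3 * Fintype.card ι := by
  classical
  have := Finset.card_filter_add_card_filter_not (s := (Finset.univ : Finset (ι × Fin 3)))
    (fun e => ∃ p ∈ C.region, C.coord e.1 e.2 p < 0)
  rw [Finset.card_univ, Fintype.card_prod, Fintype.card_fin, mul_comm] at this
  rw [← this, innerSides, outerSides]
  congr 3
  ext e
  push Not
  rfl

open Classical in
/-- The vertices from which `σ • u` does not point into the region. -/
noncomputable def blocked (σ : ℝ) : Finset E :=
  C.verts.filter fun x => ¬ C.PointsIn x (σ • C.u)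

theorem mem_blocked {σ : ℝ} {x : E} :
    x ∈ C.blocked σ ↔ x ∈ C.verts ∧ ¬ C.PointsIn x (σ • C.u) := by
  simp [blocked]

/-- A point of the region is an average of vertices; if its `ψ`-value is the minimum, only the
unique minimizing vertex can carry weight. -/
theorem mem_blocked_of_isMin {σ : ℝ} (hσ : σ ≠ 0) {x : E} (hx : x ∈ C.verts)
    (hmin : ∀ v ∈ C.verts, C.ψ x ≤ C.ψ v) : x ∈ C.blocked σ := by
  refine C.mem_blocked.2 ⟨hx, ?_⟩
  rintro ⟨ε, hε, hmem⟩
  obtain ⟨t, ht⟩ := (C.mem_region _).1 hmem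
  set y := x + ε • σ • C.u with hy
  have hψ : C.ψ y = C.ψ x := by simp [hy, C.ψ_u]
  have hsum : ∑ j, C.coord t j y * (C.ψ (C.vert t j) - C.ψ x) = 0 := by
    simp_rw [mul_sub, Finset.sum_sub_distrib, ← Finset.sum_mul, C.sum_coord, ← C.ψ_eq_sum, hψ]
    ring
  rw [Finset.sum_eq_zero_iff_of_nonneg fun j _ =>
    mul_nonneg (ht j) (sub_nonneg.2 (hmin _ (C.vert_mem_verts t j)))] at hsum
  have hyx : y = x := by
    conv_lhs => rw [← C.sum_coord_smul t y]
    conv_rhs => rw [← one_smul ℝ x, ← C.sum_coord t y, Finset.sum_smul]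
    refine Finset.sum_congr rfl fun j _ => ?_
    rcases mul_eq_zero.1 (hsum j (Finset.mem_univ j)) with h | h
    · rw [h, zero_smul, zero_smul]
    · rw [C.ψ_injOn (C.vert_mem_verts t j) hx (sub_eq_zero.1 h)]
  rw [hy, add_eq_left] at hyx
  simp [hε.ne', hσ, C.u_ne] at hyx

open Classical in
-- Send a side to its right endpoint, from which `-σ • u` crosses the boundary. The vertex
-- minimizing `ψ` is blocked but is no right endpoint, whence the extra 1. Sides with the same right
-- endpoint overlap in `ψ`; since each has the region on one side of its line, their points over a
-- common value coincide, and so do the sides.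
theorem card_outerSides_filter_lt (hne : C.verts.Nonempty) {σ : ℝ} (hσ : σ ≠ 0) :
    (C.outerSides.filter fun e => 0 < (C.coord e.1 e.2).linear (σ • C.u)).card + 1 ≤
      (C.blocked (-σ)).card := by
  obtain ⟨x, hx, hmin⟩ := C.verts.exists_min_image C.ψ hne
  have hxb := C.mem_blocked_of_isMin (neg_ne_zero.2 hσ) hx hmin
  rw [← Finset.card_erase_add_one hxb, add_le_add_iff_right]
  refine Finset.card_le_card_of_injOn (fun e => C.right e.1 e.2) ?_ ?_
  · intro e he
    obtain ⟨he, hpos⟩ := Finset.mem_filter.1 he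
    have he := (Finset.mem_filter.1 he).2
    refine Finset.mem_coe.2 (Finset.mem_erase.2
      ⟨fun h => ?_, C.mem_blocked.2 ⟨C.vert_mem_verts _ _, ?_⟩⟩)
    · have h1 := hmin _ (C.vert_mem_verts e.1 (C.leftIdx e.1 e.2))
      have h2 := C.ψ_left_lt_right e.1 e.2
      simp only at h
      rw [h] at h2
      exact absurd h1 (not_le.2 h2)
    · rintro ⟨ε, hε, hmem⟩
      have := he _ hmem
      rw [AffineMap.apply_add_smul] at this
      change 0 ≤ C.coord e.1 e.2 (C.right e.1 e.2) + _ at this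
      rw [C.coord_right, neg_smul, map_neg] at this
      nlinarith
  · intro e he e' he' hr
    obtain ⟨he, hpos⟩ := Finset.mem_filter.1 he
    obtain ⟨he', hpos'⟩ := Finset.mem_filter.1 he'
    have he := (Finset.mem_filter.1 he).2
    have he' := (Finset.mem_filter.1 he').2
    simp only at hr
    have hl : max (C.ψ (C.left e.1 e.2)) (C.ψ (C.left e'.1 e'.2)) < C.ψ (C.right e.1 e.2) :=
      max_lt (C.ψ_left_lt_right _ _) (by rw [hr]; exact C.ψ_left_lt_right _ _)
    obtain ⟨c, hc1, hc2⟩ := exists_between hl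
    rw [max_lt_iff] at hc1
    obtain ⟨m, hm, hmc⟩ := C.exists_coord_eq_zero e.1 e.2 c
    obtain ⟨m', hm', hmc'⟩ := C.exists_coord_eq_zero e'.1 e'.2 c
    have hon : C.OnSide e.1 e.2 m := C.onSide_iff.2 ⟨hm, by rw [hmc]; exact hc1.1, by rwa [hmc]⟩
    have hon' : C.OnSide e'.1 e'.2 m' :=
      C.onSide_iff.2 ⟨hm', by rw [hmc']; exact hc1.2, by rwa [hmc', ← hr]⟩
    rw [map_smul, smul_eq_mul] at hpos hpos'
    obtain ⟨τ, hτ⟩ := C.ker_ψ (m' - m) (by rw [map_sub, hmc, hmc', sub_self])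
    have h1 : 0 ≤ (C.coord e.1 e.2).linear (m' - m) := by
      rw [AffineMap.linear_sub_apply, hm, sub_zero]; exact he _ (hon'.mem_region C)
    have h2 : (C.coord e'.1 e'.2).linear (m' - m) ≤ 0 := by
      rw [AffineMap.linear_sub_apply, hm', zero_sub, neg_nonpos]; exact he' _ (hon.mem_region C)
    rw [hτ, map_smul, smul_eq_mul] at h1 h2
    have hsign : 0 < (C.coord e.1 e.2).linear C.u ↔ 0 < (C.coord e'.1 e'.2).linear C.u := by
      rcases hσ.lt_or_gt with h | h
      · exact iff_of_false (fun h' => by nlinarith) (fun h' => by nlinarith)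
      · exact iff_of_true (pos_of_mul_pos_right hpos h.le) (pos_of_mul_pos_right hpos' h.le)
    have hτ0 : τ = 0 := by
      rcases (C.linear_u_ne e.1 e.2).lt_or_gt with h | h
      · have h' := lt_of_le_of_ne (not_lt.1 (mt hsign.2 h.not_gt)) (C.linear_u_ne e'.1 e'.2)
        apply le_antisymm <;> by_contra! <;> nlinarith
      · have h' := hsign.1 h
        apply le_antisymm <;> by_contra! <;> nlinarith
    rw [hτ0, zero_smul, sub_eq_zero] at hτ
    subst hτ
    exact hon.unique C hon' hsign

theorem card_outerSides_le (hne : C.verts.Nonempty) :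
    C.outerSides.card + 2 ≤ (C.blocked 1).card + (C.blocked (-1)).card := by
  classical
  have h1 := C.card_outerSides_filter_lt hne (σ := 1) one_ne_zero
  have h2 := C.card_outerSides_filter_lt hne (σ := -1) (by norm_num)
  rw [neg_neg] at h2
  have h3 := Finset.card_filter_add_card_filter_not (s := C.outerSides)
    (fun e => 0 < (C.coord e.1 e.2).linear ((1 : ℝ) • C.u))
  have h4 : (C.outerSides.filter fun e => ¬ 0 < (C.coord e.1 e.2).linear ((1 : ℝ) • C.u)) =
      C.outerSides.filter fun e => 0 < (C.coord e.1 e.2).linear ((-1 : ℝ) • C.u) := by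
    refine Finset.filter_congr fun e _ => ?_
    have := C.linear_u_ne e.1 e.2
    simp only [one_smul, neg_smul, map_neg, not_lt, neg_pos]
    exact ⟨fun h => lt_of_le_of_ne h this, le_of_lt⟩
  rw [h4] at h3
  omega

/-! ### Counting the directions `u` and `-u` at the vertices -/

/-- Pairs (sign, vertex) whose direction points into the region are matched with a triangle having
the vertex as a corner, or with an incidence. A triangle is entered vertically from only one of its
vertices, the middle one for `ψ`, and with only one sign; a side is crossed inwards with only one
sign. -/
theorem two_mul_card_verts_le :
    2 * C.verts.card ≤ Fintype.card ι + C.incidences.card +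
      ((C.blocked 1).card + (C.blocked (-1)).card) := by
  classical
  let Q : ℝ → Finset E := fun σ => C.verts.filter fun x => C.PointsIn x (σ • C.u)
  let S : Finset (Σ _ : ℝ, E) := ({1, -1} : Finset ℝ).sigma Q
  let R : Finset (ι ⊕ ((ι × Fin 3) × E)) := Finset.univ.disjSum C.incidences
  have hQ : ∀ σ, (Q σ).card + (C.blocked σ).card = C.verts.card := fun σ =>
    Finset.card_filter_add_card_filter_not _
  have hS : S.card = (Q 1).card + (Q (-1)).card := by
    rw [Finset.card_sigma, Finset.sum_pair (by norm_num)]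
  have hR : R.card = Fintype.card ι + C.incidences.card := by
    rw [Finset.card_disjSum, Finset.card_univ]
  have hmem : ∀ {q : Σ _ : ℝ, E}, q ∈ S →
      (q.1 = 1 ∨ q.1 = -1) ∧ q.2 ∈ C.verts ∧ C.PointsIn q.2 (q.1 • C.u) := by
    intro q hq
    simpa [S, Q] using hq
  have hle : S.card ≤ R.card := by
    refine Finset.card_le_card_of_forall_subsingleton
      (fun q r => Sum.elim (fun t => (∃ j, q.2 = C.vert t j) ∧ C.WeakCone t q.2 (q.1 • C.u))
        (fun f => f.2 = q.2 ∧ C.WeakCone f.1.1 q.2 (q.1 • C.u)) r) ?_ ?_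
    · rintro ⟨σ, x⟩ hq
      obtain ⟨-, hx, hin⟩ := hmem hq
      simp only at hx hin
      obtain ⟨t, ht⟩ := C.exists_weakCone (C.mem_region_of_mem_verts hx) hin
      rcases C.trichotomy (fun k => (ht k).elim le_of_lt fun h => h.1.ge) with h | ⟨j, hj⟩ | h
      · obtain ⟨s, i, rfl⟩ := C.mem_verts.1 hx
        exact absurd h (C.vert_not_interior t s i)
      · exact ⟨Sum.inr ((t, j), x), Finset.inr_mem_disjSum.2 (C.mem_incidences.2 ⟨hx, hj⟩),
          rfl, ht⟩
      · exact ⟨Sum.inl t, Finset.inl_mem_disjSum.2 (Finset.mem_univ t), h, ht⟩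
    · rintro (t | ⟨⟨t, j⟩, y⟩) hr ⟨σ, x⟩ ⟨hS, hx⟩ ⟨τ, x'⟩ ⟨hS', hx'⟩
      · obtain ⟨hσ, -, -⟩ := hmem hS
        obtain ⟨hτ, -, -⟩ := hmem hS'
        obtain ⟨⟨j, rfl⟩, hx⟩ := hx
        obtain ⟨⟨k, rfl⟩, hx'⟩ := hx'
        simp only at hσ hτ hx hx'
        have hσ0 : σ ≠ 0 := by rcases hσ with rfl | rfl <;> norm_num
        have hτ0 : τ ≠ 0 := by rcases hτ with rfl | rfl <;> norm_num
        have p : ∀ i, i ≠ j → 0 < (C.coord t i).linear (σ • C.u) := fun i hi =>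
          WeakCone.linear_pos C hi hσ0 hx
        have p' : ∀ i, i ≠ k → 0 < (C.coord t i).linear (τ • C.u) := fun i hi =>
          WeakCone.linear_pos C hi hτ0 hx'
        by_cases hστ : σ = τ
        · subst hστ
          by_cases hjk : j = k
          · rw [hjk]
          -- Entering from two different corners would increase every coordinate, but their sum is
          -- constant.
          have : 0 < ∑ i, (C.coord t i).linear (σ • C.u) :=
            Finset.sum_pos (fun i _ => by
              by_cases hi : i = j
              · exact p' i (hi ▸ hjk)
              · exact p i hi) Finset.univ_nonempty
          rw [C.sum_coord_linear] at this
          exact absurd this (lt_irrefl _)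
        -- With opposite signs, a coordinate vanishing at both corners would increase along both `u`
        -- and `-u`.
        · have hthird : ∀ a b : Fin 3, ∃ i, i ≠ a ∧ i ≠ b := by decide
          obtain ⟨i, hij, hik⟩ := hthird j k
          have h1 := p i hij
          have h2 := p' i hik
          rw [map_smul, smul_eq_mul] at h1 h2
          rcases hσ with rfl | rfl <;> rcases hτ with rfl | rfl
          · exact absurd rfl hστ
          · linarith
          · linarith
          · exact absurd rfl hστ
      · obtain ⟨hσ, -, -⟩ := hmem hS
        obtain ⟨hτ, -, -⟩ := hmem hS'
        obtain ⟨rfl, hx⟩ := hx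
        obtain ⟨rfl, hx'⟩ := hx'
        have hon := (C.mem_incidences.1 (Finset.inr_mem_disjSum.1 hr)).2
        simp only at hσ hτ hx hx' hon
        have h1 := ((hx j).resolve_left (by rw [hon.1]; exact lt_irrefl _)).2
        have h2 := ((hx' j).resolve_left (by rw [hon.1]; exact lt_irrefl _)).2
        rw [map_smul, smul_eq_mul] at h1 h2
        have hne := C.linear_u_ne t j
        rcases hσ with rfl | rfl <;> rcases hτ with rfl | rfl
        · rfl
        · exact absurd (by linarith) hne
        · exact absurd (by linarith) hne
        · rfl
  have h1 := hQ 1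
  have h2 := hQ (-1)
  omega

/-! ### Vertices inside sides -/

/-- Around a vertex in the relative interior of a side, the region contains points on both sides
of it. -/
theorem OnSide.pointsIn {t : ι} {j : Fin 3} {x : E} (h : C.OnSide t j x) (hx : x ∈ C.verts)
    (w : E) : C.PointsIn x w := by
  rcases le_or_gt 0 ((C.coord t j).linear w) with hw | hw
  · exact (h.weakCone C hw).pointsIn C
  obtain ⟨s, k, rfl⟩ := C.mem_verts.1 hx
  -- A direction `v` into a triangle with this vertex must leave `t`. Then `w` is a positive
  -- multiple of `v` plus a vector parallel to the side.
  obtain ⟨v, hv, hv0⟩ := C.exists_strictCone_vert s k _ (C.linear_ne_zero t j)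
  have hneg : (C.coord t j).linear v < 0 := by
    refine lt_of_le_of_ne (not_lt.1 fun hpos => ?_) hv0
    exact h.ne_of_vert C (hv.eq C (h.strictCone C hpos))
  set c := (C.coord t j).linear w / (C.coord t j).linear v with hc
  have hcpos : 0 < c := div_pos_of_neg_of_neg hw hneg
  have h1 := (hv.weakCone C).pointsIn C |>.smul C hcpos
  have h2 : C.PointsIn (C.vert s k) (w - c • v) := (h.weakCone C (by
    rw [map_sub, map_smul, smul_eq_mul, hc, div_mul_cancel₀ _ hv0, sub_self])).pointsIn C
  simpa using h1.add C h2

/-- A vertex lies in the relative interior of at most one side. -/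
theorem OnSide.unique_of_mem_verts {s t : ι} {i j : Fin 3} {x : E} (ht : C.OnSide t j x)
    (hs : C.OnSide s i x) (hx : x ∈ C.verts) : (t, j) = (s, i) := by
  by_cases hst : s = t
  · subst hst
    exact ht.unique C hs (by
      by_cases hij : j = i
      · rw [hij]
      · have := hs.2 j hij
        rw [ht.1] at this
        exact absurd this (lt_irrefl _))
  obtain ⟨c, hc, hcoord⟩ := ht.exists_coord_eq_neg C hs hst
  obtain ⟨q, k, rfl⟩ := C.mem_verts.1 hx
  obtain ⟨v, hv, hv0⟩ := C.exists_strictCone_vert q k _ (C.linear_ne_zero t j)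
  exfalso
  -- The triangles `s` and `t` already fill both sides of the line near the point, leaving no room
  -- for the triangle having it as a vertex.
  rcases hv0.lt_or_gt with h | h
  · refine hs.ne_of_vert C (hv.eq C (hs.strictCone C ?_))
    rw [C.linear_eq_of_coord_eq hcoord]
    nlinarith
  · exact ht.ne_of_vert C (hv.eq C (ht.strictCone C h))

open Classical in
theorem card_incidences_add_le :
    C.incidences.card + (C.blocked 1 ∪ C.blocked (-1)).card ≤ C.verts.card := by
  have hsub : C.blocked 1 ∪ C.blocked (-1) ⊆ C.verts :=
    Finset.union_subset (Finset.filter_subset _ _) (Finset.filter_subset _ _)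
  rw [← Finset.card_sdiff_add_card_eq_card hsub, add_le_add_iff_right]
  refine Finset.card_le_card_of_injOn Prod.snd ?_ ?_
  · rintro ⟨f, x⟩ hq
    obtain ⟨hx, hon⟩ := C.mem_incidences.1 (Finset.mem_coe.1 hq)
    refine Finset.mem_coe.2 (Finset.mem_sdiff.2 ⟨hx, fun h => ?_⟩)
    rcases Finset.mem_union.1 h with h | h
    · exact (C.mem_blocked.1 h).2 (hon.pointsIn C hx _)
    · exact (C.mem_blocked.1 h).2 (hon.pointsIn C hx _)
  · rintro ⟨f, x⟩ hq ⟨g, y⟩ hq' rfl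
    obtain ⟨hx, hon⟩ := C.mem_incidences.1 (Finset.mem_coe.1 hq)
    obtain ⟨-, hon'⟩ := C.mem_incidences.1 (Finset.mem_coe.1 hq')
    rw [Prod.mk.injEq]
    exact ⟨hon.unique_of_mem_verts C hon' hx, rfl⟩

/-! ### Vertices at which both directions are blocked -/

open Classical in
-- With vertices on both sides in `ψ`, the collinearity lemma would put the triangle with corner `x`
-- on a single line through `x`.
theorem isMin_or_isMax_of_blocked {x : E} (hx : x ∈ C.blocked 1 ∩ C.blocked (-1)) :
    (∀ v ∈ C.verts, C.ψ x ≤ C.ψ v) ∨ ∀ v ∈ C.verts, C.ψ v ≤ C.ψ x := by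
  by_contra! hno
  obtain ⟨⟨p, hp, hpx⟩, q, hq, hxq⟩ := hno
  obtain ⟨hx1, hx2⟩ := Finset.mem_inter.1 hx
  obtain ⟨hxv, h1⟩ := C.mem_blocked.1 hx1
  obtain ⟨-, h2⟩ := C.mem_blocked.1 hx2
  have hp := C.mem_region_of_mem_verts hp
  have hq := C.mem_region_of_mem_verts hq
  obtain ⟨t, k, rfl⟩ := C.mem_verts.1 hxv
  obtain ⟨-, d, hd⟩ := C.smul_sub_eq_of_blocked h1 h2 hp hq hpx hxq
  have hcol : ∀ a, k ≠ a → ∃ c : ℝ, C.vert t a - C.vert t k = c • (q - C.vert t k) := by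
    intro a hka
    rcases (C.ψ_vert_ne t hka).lt_or_gt with h | h
    · obtain ⟨⟨c, hc⟩, -⟩ := C.smul_sub_eq_of_blocked h1 h2 hp (C.vert_mem t a) hpx h
      exact ⟨c * d, by rw [hc, hd, smul_smul]⟩
    · exact (C.smul_sub_eq_of_blocked h1 h2 (C.vert_mem t a) hq h hxq).2
  obtain ⟨a, b, hka, hkb, hab⟩ := Fin.exists_other_two k
  obtain ⟨α, hα⟩ := hcol a hka
  obtain ⟨β, hβ⟩ := hcol b hkb
  have e1 := congrArg (C.coord t a).linear hα
  have e2 := congrArg (C.coord t a).linear hβ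
  rw [AffineMap.linear_sub_apply, C.coord_self, C.coord_ne _ _ _ hka.symm, map_smul,
    smul_eq_mul] at e1
  rw [AffineMap.linear_sub_apply, C.coord_ne _ _ _ hab, C.coord_ne _ _ _ hka.symm, map_smul,
    smul_eq_mul, sub_self] at e2
  rcases mul_eq_zero.1 e2.symm with h | h
  · rw [h, zero_smul, sub_eq_zero] at hβ
    exact hkb (C.vert_injective t hβ.symm)
  · rw [h] at e1; norm_num at e1

open Classical in
theorem card_blocked_inter_le : (C.blocked 1 ∩ C.blocked (-1)).card ≤ 2 := by
  let A := C.verts.filter fun x => ∀ v ∈ C.verts, C.ψ x ≤ C.ψ v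
  let B := C.verts.filter fun x => ∀ v ∈ C.verts, C.ψ v ≤ C.ψ x
  have hA : A.card ≤ 1 := Finset.card_le_one.2 fun x hx y hy => by
    obtain ⟨hx, hx'⟩ := Finset.mem_filter.1 hx
    obtain ⟨hy, hy'⟩ := Finset.mem_filter.1 hy
    exact C.ψ_injOn hx hy (le_antisymm (hx' y hy) (hy' x hx))
  have hB : B.card ≤ 1 := Finset.card_le_one.2 fun x hx y hy => by
    obtain ⟨hx, hx'⟩ := Finset.mem_filter.1 hx
    obtain ⟨hy, hy'⟩ := Finset.mem_filter.1 hy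
    exact C.ψ_injOn hx hy (le_antisymm (hy' x hx) (hx' y hy))
  have hsub : C.blocked 1 ∩ C.blocked (-1) ⊆ A ∪ B := fun x hx => by
    have hxv := (C.mem_blocked.1 (Finset.mem_inter.1 hx).1).1
    rw [Finset.mem_union, Finset.mem_filter, Finset.mem_filter]
    exact (C.isMin_or_isMax_of_blocked hx).imp (⟨hxv, ·⟩) (⟨hxv, ·⟩)
  have h1 := Finset.card_le_card hsub
  have h2 := Finset.card_union_le A B
  omega

/-! ### Extreme points -/

open Classical in
-- An extreme point has no two opposite nonzero directions into the region. This rules out points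
-- interior to a triangle or a side, and also both `u` and `-u` being unblocked.
theorem mem_blocked_of_mem_extremePoints {x : E} (hx : x ∈ C.region.extremePoints ℝ) :
    x ∈ C.blocked 1 ∪ C.blocked (-1) := by
  have hxv : x ∈ C.verts := by
    obtain ⟨t, ht⟩ := (C.mem_region x).1 hx.1
    rcases C.trichotomy ht with h | ⟨j, hj⟩ | h
    · have key : ∀ w, C.PointsIn x w := fun w => WeakCone.pointsIn C fun j => Or.inl (h j)
      exact absurd (C.eq_zero_of_mem_extremePoints hx (key _) (key _)) C.u_ne
    · have hlin : (C.coord t j).linear (C.right t j - C.left t j) = 0 := by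
        rw [AffineMap.linear_sub_apply, coord_left, coord_right, sub_zero]
      have := C.eq_zero_of_mem_extremePoints hx ((hj.weakCone C hlin.ge).pointsIn C)
        ((hj.weakCone C (by rw [map_neg, hlin, neg_zero])).pointsIn C)
      have hlt := C.ψ_left_lt_right t j
      rw [sub_eq_zero.1 this] at hlt
      exact absurd hlt (lt_irrefl _)
    · exact C.mem_verts.2 ⟨t, h⟩
  by_contra hno
  rw [Finset.mem_union, mem_blocked, mem_blocked, one_smul, neg_one_smul] at hno
  push Not at hno
  exact C.u_ne (C.eq_zero_of_mem_extremePoints hx (hno.1 hxv) (hno.2 hxv))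

/-- If no two triangles share a side, the region has at most three extreme points. -/
theorem card_extremePoints_le
    (hns : ∀ s t i j, s ≠ t → C.left s i = C.left t j → C.right s i = C.right t j → False)
    (S : Finset E) (hS : ∀ x ∈ S, x ∈ C.region.extremePoints ℝ) : S.card ≤ 3 := by
  classical
  rcases S.eq_empty_or_nonempty with rfl | ⟨x, hx⟩
  · simp
  have hsub : S ⊆ C.blocked 1 ∪ C.blocked (-1) := fun y hy =>
    C.mem_blocked_of_mem_extremePoints (hS y hy)
  have hne : C.verts.Nonempty := by
    obtain ⟨t, -⟩ := (C.mem_region x).1 (hS x hx).1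
    exact ⟨_, C.vert_mem_verts t 0⟩
  have h0 := Finset.card_le_card hsub
  have h1 := C.card_innerSides_le hns
  have h2 := C.card_innerSides_add_card_outerSides
  have h3 := C.card_outerSides_le hne
  have h4 := C.two_mul_card_verts_le
  have h5 := C.card_incidences_add_le
  have h6 := C.card_blocked_inter_le
  have h7 := Finset.card_union_add_card_inter (C.blocked 1) (C.blocked (-1))
  -- With U = |B₊ ∪ B₋| and b = |B₊| + |B₋|: 6V ≤ 3n + 3I + 3b ≤ 6I + 4b - 2 ≤ 6V - 6U + 4b - 2, and
  -- b ≤ U + 2, so 2U ≤ 6.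
  omega

end GenericTiling

/-! ### Barycentric coordinates of `Affine.Triangle` -/

namespace Affine.Triangle

/-- The vertices of a triangle in the plane as an affine basis. -/
noncomputable def affineBasis (t : Affine.Triangle ℝ Plane) : AffineBasis (Fin 3) ℝ Plane :=
  ⟨t.points, t.independent, by
    rw [t.independent.affineSpan_eq_top_iff_card_eq_finrank_add_one]; simp⟩

theorem mem_setInterior_iff (t : Affine.Triangle ℝ Plane) (I : Set ℝ) (x : Plane) :
    x ∈ t.setInterior I ↔ ∀ j, t.affineBasis.coord j x ∈ I := by
  have h := t.affineCombination_mem_setInterior_iff (I := I)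
    (t.affineBasis.sum_coord_apply_eq_one x)
  have hx := t.affineBasis.affineCombination_coord_eq_self x
  change Finset.univ.affineCombination ℝ t.points _ = x at hx
  rwa [hx] at h

theorem coord_le_one (t : Affine.Triangle ℝ Plane) {x : Plane}
    (h : ∀ j, 0 ≤ t.affineBasis.coord j x) (j : Fin 3) : t.affineBasis.coord j x ≤ 1 := by
  rw [← t.affineBasis.sum_coord_apply_eq_one x]
  exact Finset.single_le_sum (fun i _ => h i) (Finset.mem_univ j)

theorem mem_closedInterior_iff (t : Affine.Triangle ℝ Plane) (x : Plane) :
    x ∈ t.closedInterior ↔ ∀ j, 0 ≤ t.affineBasis.coord j x :=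
  (t.mem_setInterior_iff _ x).trans
    ⟨fun h j => (h j).1, fun h j => ⟨h j, t.coord_le_one h j⟩⟩

theorem mem_interior_of_coord_pos (t : Affine.Triangle ℝ Plane) {x : Plane}
    (h : ∀ j, 0 < t.affineBasis.coord j x) : x ∈ t.interior := by
  refine (t.mem_setInterior_iff _ x).2 fun j => ⟨h j, ?_⟩
  rw [← t.affineBasis.sum_coord_apply_eq_one x]
  obtain ⟨a, -, hja, -, -⟩ := Fin.exists_other_two j
  exact Finset.single_lt_sum hja.symm (Finset.mem_univ _) (Finset.mem_univ a) (h a)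
    fun k _ _ => (h k).le

end Affine.Triangle

/-! ### Extreme points of a convex hull -/

/-- The points of a convex independent family are extreme points of its convex hull. -/
theorem ConvexIndependent.mem_extremePoints_convexHull {ι E : Type*} [AddCommGroup E] [Module ℝ E]
    {v : ι → E} (hv : ConvexIndependent ℝ v) (i : ι) :
    v i ∈ (convexHull ℝ (Set.range v)).extremePoints ℝ := by
  refine ⟨subset_convexHull ℝ _ ⟨i, rfl⟩, fun y hy z hz hx => ?_⟩
  have hnot : v i ∉ convexHull ℝ (v '' {i}ᶜ) := fun h => hv _ _ h rfl
  have hrange : Set.range v = insert (v i) (v '' {i}ᶜ) := by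
    rw [← Set.image_insert_eq, ← Set.image_univ]
    congr 1
    ext j
    simp [em]
  rcases (v '' {i}ᶜ).eq_empty_or_nonempty with hempty | hne
  · rw [hrange, hempty] at hy
    simpa using hy
  -- The hull is the cone from `v i` over the hull of the other points. If `v i` is strictly between
  -- `y` and `z`, the displacements cancel, and unless `y = v i` this exhibits `v i` as an average
  -- of `q` and `q'`.
  have hrep : ∀ y ∈ convexHull ℝ (Set.range v),
      ∃ a : ℝ, 0 ≤ a ∧ ∃ q ∈ convexHull ℝ (v '' {i}ᶜ), y = v i + a • (q - v i) := by
    intro y hy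
    rw [hrange, convexHull_insert hne, mem_convexJoin] at hy
    obtain ⟨_, rfl, q, hq, b, a, -, ha, hab, rfl⟩ := hy
    refine ⟨a, ha, q, hq, ?_⟩
    rw [← eq_sub_iff_add_eq] at hab
    rw [hab]; module
  obtain ⟨a, ha, q, hq, rfl⟩ := hrep y hy
  obtain ⟨b, hb, q', hq', rfl⟩ := hrep z hz
  obtain ⟨r, s, hr, hs, hrs, hx⟩ := hx
  rcases ha.eq_or_lt with rfl | ha
  · simp
  refine absurd ?_ hnot
  have hpos : 0 < r * a + s * b := by positivity
  have hx' : (r * a) • q + (s * b) • q' = (r * a + s * b) • v i := by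
    have hr' : r = 1 - s := by linarith
    rw [← sub_eq_zero] at hx ⊢
    rw [← hx, hr']; module
  have := convex_convexHull ℝ (v '' {i}ᶜ) hq hq' (a := r * a / (r * a + s * b))
    (b := s * b / (r * a + s * b)) (by positivity) (by positivity) (by field_simp)
  convert this using 1
  rw [div_eq_inv_mul, div_eq_inv_mul, mul_smul _ (r * a), mul_smul _ (s * b), ← smul_add, hx',
    smul_smul,
    inv_mul_cancel₀ hpos.ne', one_smul]

/-! ### Choice of the generic functional -/

theorem exists_spanning_ker (ψ : Plane →ₗ[ℝ] ℝ) (hψ : ψ ≠ 0) :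
    ∃ u : Plane, ψ u = 0 ∧ u ≠ 0 ∧ ∀ v, ψ v = 0 → ∃ c : ℝ, v = c • u := by
  have hr : Module.finrank ℝ (LinearMap.range ψ) = 1 := by
    rw [LinearMap.range_eq_top.2 (LinearMap.surjective hψ)]; simp
  have h := ψ.finrank_range_add_finrank_ker
  rw [hr, finrank_euclideanSpace_fin] at h
  have hk : Module.finrank ℝ (LinearMap.ker ψ) = 1 := by omega
  obtain ⟨u, hu, hspan⟩ := finrank_eq_one_iff'.1 hk
  refine ⟨u, u.2, by simpa using hu, fun v hv => ?_⟩
  obtain ⟨c, hc⟩ := hspan ⟨v, hv⟩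
  exact ⟨c, (congrArg Subtype.val hc).symm⟩

/-- A tiling by triangles of a nonempty convex set in the plane admits a generic functional. -/
theorem IsTriangleTiling.exists_genericTiling {T : Set (Affine.Triangle ℝ Plane)} {P : Set Plane}
    (hT : IsTriangleTiling T P) (hfin : T.Finite) (hP : Convex ℝ P) (hne : P.Nonempty) :
    ∃ C : GenericTiling T Plane, C.region = P ∧ ∀ t j, C.vert t j = t.1.points j := by
  have := hfin.to_subtype
  -- Finitely many nonzero differences of vertices; some functional vanishes on none of them.
  let I := {q : (T × Fin 3) × (T × Fin 3) // q.1.1.1.points q.1.2 ≠ q.2.1.1.points q.2.2}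
  obtain ⟨ψ, hψ⟩ := Module.exists_dual_forall_apply_ne_zero (K := ℝ)
    (fun q : I => q.1.1.1.1.points q.1.1.2 - q.1.2.1.1.points q.1.2.2)
    fun q => sub_ne_zero.2 q.2
  have hψ0 : ψ ≠ 0 := by
    rintro rfl
    obtain ⟨x, hx⟩ := hne
    rw [← hT.1, Set.mem_iUnion₂] at hx
    obtain ⟨t, ht, -⟩ := hx
    exact hψ ⟨((⟨t, ht⟩, 0), (⟨t, ht⟩, 1)),
      fun h => zero_ne_one (t.independent.injective h)⟩ rfl
  obtain ⟨u, hu, hu0, hker⟩ := exists_spanning_ker ψ hψ0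
  refine ⟨{
    vert := fun t j => t.1.points j
    coord := fun t j => t.1.affineBasis.coord j
    region := P
    ψ := ψ
    u := u
    coord_self := fun t j => t.1.affineBasis.coord_apply_eq j
    coord_ne := fun t j k h => t.1.affineBasis.coord_apply_ne h
    sum_coord := fun t x => t.1.affineBasis.sum_coord_apply_eq_one x
    sum_coord_smul := fun t x => t.1.affineBasis.linear_combination_coord_eq_self x
    eq_of_common_interior := fun s t x hs ht => by
      by_contra hst
      exact Set.disjoint_left.1 (hT.2 s s.2 t t.2 fun h => hst (Subtype.ext h))
        (s.1.mem_interior_of_coord_pos hs) (t.1.mem_interior_of_coord_pos ht)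
    convex_region := hP
    mem_region := fun x => by
      rw [← hT.1, Set.mem_iUnion₂]
      simp only [Affine.Triangle.mem_closedInterior_iff, Subtype.exists, exists_prop]
    ψ_u := hu
    u_ne := hu0
    ker_ψ := hker
    ψ_inj := fun s t j k h => by
      by_contra hne
      exact hψ ⟨((s, j), (t, k)), hne⟩ (by rw [map_sub, h, sub_self]) }, rfl, fun _ _ => rfl⟩

/-! ### Conclusion -/

theorem theorem6 (k : ℕ) (hk : 4 ≤ k) (P : Set Plane) (hP : IsConvexGon k P)
    (T : Set (Affine.Triangle ℝ Plane)) (hfin : T.Finite) (hT : IsTriangleTiling T P) :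
    ∃ s ∈ T, ∃ t ∈ T, s ≠ t ∧ ∃ S : Set Plane, IsSideOf S s ∧ IsSideOf S t := by
  classical
  obtain ⟨v, hv, rfl⟩ := hP
  have := hfin.fintype
  obtain ⟨C, hregion, hvert⟩ := hT.exists_genericTiling hfin (convex_convexHull ℝ _)
    ⟨v ⟨0, by omega⟩, subset_convexHull ℝ _ ⟨_, rfl⟩⟩
  by_contra! hno
  have hside : ∀ t j, IsSideOf (segment ℝ (C.left t j) (C.right t j)) t.1 := fun t j =>
    ⟨C.leftIdx t j, C.rightIdx t j, (C.idx_distinct t j).2.2, by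
      rw [← hvert, ← hvert]; rfl⟩
  have hcard := C.card_extremePoints_le (fun s t i j hst hl hr => by
    refine hno s s.2 t t.2 (fun h => hst (Subtype.ext h)) _ (hside s i) ?_
    rw [hl, hr]
    exact hside t j) (Finset.univ.image v) (fun x hx => by
      obtain ⟨i, -, rfl⟩ := Finset.mem_image.1 hx
      rw [hregion]
      exact hv.mem_extremePoints_convexHull i)
  rw [Finset.card_image_of_injective _ hv.injective, Finset.card_univ, Fintype.card_fin] at hcard
  omega
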